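/- \textbf{The language.} Types are $\sigma ::= \mathtt{unit} \mid \mathtt{bool} \mid \sigma_1\to\sigma_2$; the base types are $\mathtt{unit}$ and $\mathtt{bool}$. Expressions of Boolean PCF with exceptions (call-by-value, one exception constructor $\mathsf{Exc}_\sigma$ for each type $\sigma$) are $$M ::= \mathtt{fail} \mid V \mid x \mid M_1M_2 \mid \mathbf{Y}(\lambda f.\lambda x.M) \mid \mathtt{if}\ M_0\ \mathtt{then}\ M_1\ \mathtt{else}\ M_2 \mid \mathtt{raise}\ \mathsf{Exc}_\sigma\,M \mid \mathtt{try}\ M_1\ \mathtt{with}\ \mathsf{Exc}_\sigma\,x\to M_2,$$ with values $V ::= () \mid \mathtt{true} \mid \mathtt{false} \mid \lambda x.M$. Typing is the usual simple typing, where $\mathbf{Y}(\lambda f.\lambda x.M):\sigma_1\to\sigma_2$ if $M:\sigma_2$ under $f:\sigma_1\to\sigma_2$, $x:\sigma_1$; $\mathtt{fail}$ has every type; $\mathtt{raise}\ \mathsf{Exc}_\sigma\,M$ has every type if $M:\sigma$; and $\mathtt{try}\ M_1\ \mathtt{with}\ \mathsf{Exc}_\sigma\,x\to M_2$ has type $\tau$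 if $M_1:\tau$ and $M_2:\tau$ under $x:\sigma$. With evaluation contexts $$E ::= [\,] \mid E\,M \mid V\,E \mid \mathtt{if}\ E\ \mathtt{then}\ M_1\ \mathtt{else}\ M_2 \mid \mathtt{raise}\ \mathsf{Exc}_\sigma\,E \mid \mathtt{try}\ E\ \mathtt{with}\ \mathsf{Exc}_\sigma\,x\to M,$$ the reduction rules are $$E[(\lambda x.M)V]\to E[[V/x]M],\qquad E[\mathtt{fail}]\to\mathtt{fail},$$ $$E[\mathtt{if}\ \mathtt{true}\ \mathtt{then}\ M_1\ \mathtt{else}\ M_2]\to E[M_1],\qquad E[\mathtt{if}\ \mathtt{false}\ \mathtt{then}\ M_1\ \mathtt{else}\ M_2]\to E[M_2],$$ $$E[\mathbf{Y}(\lambda f.\lambda x.M)]\to E[\lambda x.[\mathbf{Y}(\lambda f.\lambda x.M)/f]M],$$ $$E[\mathtt{try}\ E'[\mathtt{raise}\ \mathsf{Exc}_\sigma\,V]\ \mathtt{with}\ \mathsf{Exc}_\sigma\,x\to M]\to E[[V/x]M],$$ the last one provided that the hole of $E'$ is not in the body of a handler for the same $\mathsf{Exc}_\sigma$ inside $E'$.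 Optionally there is also the rule $E[\mathtt{try}\ V\ \mathtt{with}\ \mathsf{Exc}_\sigma\,x\to M]\to E[V]$ for handlers whose body has become a value. The \emph{reachability problem} is: given a closed expression $M$ of base type, decide whether $M\to^*\mathtt{fail}$. \textbf{Theorem.} The reachability problem for Boolean PCF with exceptions is undecidable. It remains undecidable when it is restricted to expressions in which the only exception constructor that occurs is $\mathsf{Exc}_{\mathtt{unit}\to\mathtt{unit}}$. Both statements hold without and with the optional rule. -/

import Mathlib

namespace BPCF

/-! ### Types and expressions -/

/-- Simple types `σ ::= unit | bool | σ₁ → σ₂`. -/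
inductive Ty : Type
  | unit : Ty
  | bool : Ty
  | arr : Ty → Ty → Ty

/-- The base types are `unit` and `bool`. -/
def Ty.IsBase : Ty → Prop
  | .unit => True
  | .bool => True
  | .arr _ _ => False

/-- Expressions of Boolean PCF with exceptions, up to renaming of bound variables (de Bruijn
indices: `var 0` refers to the innermost binder). There is one exception constructor for each type,
so that the type itself serves as its name. -/
inductive Tm : Type
  /-- the error command -/
  | fail : Tm
  /-- the value `()` -/
  | unit : Tm
  /-- the value `true` -/
  | tt : Tm
  /-- the value `false` -/
  | ff : Tm
  | var : ℕ → Tm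
  /-- `λ x. M`; `x` is index `0` in `M` -/
  | lam : Tm → Tm
  | app : Tm → Tm → Tm
  /-- `Y (λ f. λ x. M)`; in `M`, `x` is index `0` and `f` is index `1` -/
  | fix : Tm → Tm
  | ite : Tm → Tm → Tm → Tm
  /-- `raise σ M`: raise the exception of type `σ` carrying the value of `M` -/
  | raise : Ty → Tm → Tm
  /-- `handle σ M N` is `try M with Exc_σ x → N`; `x` is index `0` in `N` -/
  | handle : Ty → Tm → Tm → Tm

/-- Values `V ::= () | true | false | λ x. M`. -/
def Tm.IsValue : Tm → Prop
  | .unit => True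
  | .tt => True
  | .ff => True
  | .lam _ => True
  | _ => False

/-! ### Typing -/

/-- The typing judgement `Γ ⊢ M : τ`; the `n`-th entry of `Γ` is the type of `var n`. -/
inductive HasTy : List Ty → Tm → Ty → Prop
  | fail (Γ : List Ty) (τ : Ty) : HasTy Γ .fail τ
  | unit (Γ : List Ty) : HasTy Γ .unit .unit
  | tt (Γ : List Ty) : HasTy Γ .tt .bool
  | ff (Γ : List Ty) : HasTy Γ .ff .bool
  | var (Γ : List Ty) (n : ℕ) (τ : Ty) (h : Γ[n]? = some τ) : HasTy Γ (.var n) τ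
  | lam (Γ : List Ty) (σ τ : Ty) (M : Tm) (h : HasTy (σ :: Γ) M τ) :
      HasTy Γ (.lam M) (.arr σ τ)
  | app (Γ : List Ty) (σ τ : Ty) (M N : Tm) (hM : HasTy Γ M (.arr σ τ)) (hN : HasTy Γ N σ) :
      HasTy Γ (.app M N) τ
  | fix (Γ : List Ty) (σ τ : Ty) (M : Tm) (h : HasTy (σ :: .arr σ τ :: Γ) M τ) :
      HasTy Γ (.fix M) (.arr σ τ)
  | ite (Γ : List Ty) (τ : Ty) (L M N : Tm) (hL : HasTy Γ L .bool) (hM : HasTy Γ M τ)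
      (hN : HasTy Γ N τ) : HasTy Γ (.ite L M N) τ
  | raise (Γ : List Ty) (σ τ : Ty) (M : Tm) (h : HasTy Γ M σ) : HasTy Γ (.raise σ M) τ
  | handle (Γ : List Ty) (σ τ : Ty) (M N : Tm) (hM : HasTy Γ M τ) (hN : HasTy (σ :: Γ) N τ) :
      HasTy Γ (.handle σ M N) τ

/-! ### Capture-avoiding substitution -/

/-- Extend a renaming under one binder. -/
def liftRen (ρ : ℕ → ℕ) : ℕ → ℕ
  | 0 => 0
  | n + 1 => ρ n + 1

/-- Rename the free variables of an expression. -/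
def Tm.rename : (ℕ → ℕ) → Tm → Tm
  | _, .fail => .fail
  | _, .unit => .unit
  | _, .tt => .tt
  | _, .ff => .ff
  | ρ, .var n => .var (ρ n)
  | ρ, .lam M => .lam (M.rename (liftRen ρ))
  | ρ, .app M N => .app (M.rename ρ) (N.rename ρ)
  | ρ, .fix M => .fix (M.rename (liftRen (liftRen ρ)))
  | ρ, .ite L M N => .ite (L.rename ρ) (M.rename ρ) (N.rename ρ)
  | ρ, .raise σ M => .raise σ (M.rename ρ)
  | ρ, .handle σ M N => .handle σ (M.rename ρ) (N.rename (liftRen ρ))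

/-- Extend a simultaneous substitution under one binder. -/
def liftSub (s : ℕ → Tm) : ℕ → Tm
  | 0 => .var 0
  | n + 1 => (s n).rename Nat.succ

/-- Simultaneous capture-avoiding substitution. -/
def Tm.subst : (ℕ → Tm) → Tm → Tm
  | _, .fail => .fail
  | _, .unit => .unit
  | _, .tt => .tt
  | _, .ff => .ff
  | s, .var n => s n
  | s, .lam M => .lam (M.subst (liftSub s))
  | s, .app M N => .app (M.subst s) (N.subst s)
  | s, .fix M => .fix (M.subst (liftSub (liftSub s)))
  | s, .ite L M N => .ite (L.subst s) (M.subst s) (N.subst s)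
  | s, .raise σ M => .raise σ (M.subst s)
  | s, .handle σ M N => .handle σ (M.subst s) (N.subst (liftSub s))

/-- The substitution that replaces index `0` by `V` and lowers all other indices by one. -/
def single (V : Tm) : ℕ → Tm
  | 0 => V
  | n + 1 => .var n

/-- `[V/x]M`, where `x` is index `0` of `M`. -/
def Tm.inst (M V : Tm) : Tm := M.subst (single V)

/-! ### Reduction semantics -/

/-- Evaluation contexts
`E ::= [] | E M | V E | if E M N | raise σ E | try E with Exc_σ x → N`. -/
inductive ECtx : Type
  | hole : ECtx
  | appL : ECtx → Tm → ECtx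
  | appR (V : Tm) : V.IsValue → ECtx → ECtx
  | ite : ECtx → Tm → Tm → ECtx
  | raise : Ty → ECtx → ECtx
  | handle : Ty → ECtx → Tm → ECtx

/-- `E.plug M` is `E[M]`. -/
def ECtx.plug : ECtx → Tm → Tm
  | .hole, L => L
  | .appL E N, L => .app (E.plug L) N
  | .appR V _ E, L => .app V (E.plug L)
  | .ite E M N, L => .ite (E.plug L) M N
  | .raise σ E, L => .raise σ (E.plug L)
  | .handle σ E N, L => .handle σ (E.plug L) N

/-- `E.Handles σ`: the context `E` has a part of the form `try E' with Exc_σ x → N`, where `E'` is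
an evaluation context, that is, the hole of `E` is in the scope of a handler for `Exc_σ`. -/
def ECtx.Handles (σ : Ty) : ECtx → Prop
  | .hole => False
  | .appL E _ => E.Handles σ
  | .appR _ _ E => E.Handles σ
  | .ite E _ _ => E.Handles σ
  | .raise _ E => E.Handles σ
  | .handle τ E _ => τ = σ ∨ E.Handles σ

/-- One-step reduction. The parameter `ret` tells whether the rule
`E[try V with Exc_σ x → N] ⟶ E[V]` for a handler whose body has become a value belongs to the
relation. All other rules are always there. -/
inductive Step (ret : Bool) : Tm → Tm → Prop
  | beta (E : ECtx) (M V : Tm) (hV : V.IsValue) :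
      Step ret (E.plug (.app (.lam M) V)) (E.plug (M.inst V))
  | iteTrue (E : ECtx) (M N : Tm) : Step ret (E.plug (.ite .tt M N)) (E.plug M)
  | iteFalse (E : ECtx) (M N : Tm) : Step ret (E.plug (.ite .ff M N)) (E.plug N)
  | fail (E : ECtx) : Step ret (E.plug .fail) .fail
  | unfold (E : ECtx) (M : Tm) :
      Step ret (E.plug (.fix M)) (E.plug (.lam (M.subst (liftSub (single (.fix M))))))
  | catchExc (E E' : ECtx) (σ : Ty) (V N : Tm) (hV : V.IsValue) (hE' : ¬ E'.Handles σ) :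
      Step ret (E.plug (.handle σ (E'.plug (.raise σ V)) N)) (E.plug (N.inst V))
  | handleValue (E : ECtx) (σ : Ty) (V N : Tm) (hV : V.IsValue) (hret : ret = true) :
      Step ret (E.plug (.handle σ V N)) (E.plug V)

/-- `M ⟶* fail`. -/
def ReachesFail (ret : Bool) (M : Tm) : Prop :=
  Relation.ReflTransGen (Step ret) M .fail

/-- The inputs of the reachability problem: closed expressions of base type. -/
def IsProgram (M : Tm) : Prop :=
  ∃ b : Ty, b.IsBase ∧ HasTy [] M b

/-- Every exception constructor that occurs in the expression (in a `raise` or in a handler) is the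
one of type `σ`. -/
def Tm.OnlyExc (σ : Ty) : Tm → Prop
  | .fail => True
  | .unit => True
  | .tt => True
  | .ff => True
  | .var _ => True
  | .lam M => M.OnlyExc σ
  | .app M N => M.OnlyExc σ ∧ N.OnlyExc σ
  | .fix M => M.OnlyExc σ
  | .ite L M N => L.OnlyExc σ ∧ M.OnlyExc σ ∧ N.OnlyExc σ
  | .raise τ M => τ = σ ∧ M.OnlyExc σ
  | .handle τ M N => τ = σ ∧ M.OnlyExc σ ∧ N.OnlyExc σ

/-! ### Gödel numbering of expressions, so that algorithms on expressions make sense -/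

/-- The number of a type. -/
def Ty.code : Ty → ℕ
  | .unit => 0
  | .bool => 1
  | .arr σ τ => Nat.pair σ.code τ.code + 2

/-- The type with a given number. -/
def Ty.ofCode : ℕ → Ty
  | 0 => .unit
  | 1 => .bool
  | n + 2 =>
    have : n.unpair.1 < n + 2 := lt_of_le_of_lt n.unpair_left_le (by omega)
    have : n.unpair.2 < n + 2 := lt_of_le_of_lt n.unpair_right_le (by omega)
    .arr (Ty.ofCode n.unpair.1) (Ty.ofCode n.unpair.2)

theorem Ty.ofCode_code (σ : Ty) : Ty.ofCode σ.code = σ := by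
  induction σ with
  | unit => simp [Ty.code, Ty.ofCode]
  | bool => simp [Ty.code, Ty.ofCode]
  | arr σ τ h₁ h₂ => simp [Ty.code, Ty.ofCode, h₁, h₂]

theorem Ty.code_ofCode (n : ℕ) : (Ty.ofCode n).code = n := by
  induction n using Nat.strong_induction_on with
  | _ n ih =>
    match n with
    | 0 => simp [Ty.code, Ty.ofCode]
    | 1 => simp [Ty.code, Ty.ofCode]
    | n + 2 =>
      have h₁ := ih n.unpair.1 (lt_of_le_of_lt n.unpair_left_le (by omega))
      have h₂ := ih n.unpair.2 (lt_of_le_of_lt n.unpair_right_le (by omega))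
      simp [Ty.code, Ty.ofCode, h₁, h₂]

/-- The number of an expression. -/
def Tm.code : Tm → ℕ
  | .fail => 0
  | .unit => 1
  | .tt => 2
  | .ff => 3
  | .var n => 7 * n + 4
  | .lam M => 7 * M.code + 5
  | .app M N => 7 * Nat.pair M.code N.code + 6
  | .fix M => 7 * M.code + 7
  | .ite L M N => 7 * Nat.pair L.code (Nat.pair M.code N.code) + 8
  | .raise σ M => 7 * Nat.pair σ.code M.code + 9
  | .handle σ M N => 7 * Nat.pair σ.code (Nat.pair M.code N.code) + 10

/-- The expression with a given number. -/
def Tm.ofCode : ℕ → Tm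
  | 0 => .fail
  | 1 => .unit
  | 2 => .tt
  | 3 => .ff
  | n + 4 =>
    let k := n / 7
    have h0 : k < n + 4 := by omega
    have h1 : k.unpair.1 < n + 4 := lt_of_le_of_lt k.unpair_left_le h0
    have h2 : k.unpair.2 < n + 4 := lt_of_le_of_lt k.unpair_right_le h0
    have h21 : k.unpair.2.unpair.1 < n + 4 := lt_of_le_of_lt (Nat.unpair_left_le _) h2
    have h22 : k.unpair.2.unpair.2 < n + 4 := lt_of_le_of_lt (Nat.unpair_right_le _) h2
    match n % 7 with
    | 0 => .var k
    | 1 => .lam (Tm.ofCode k)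
    | 2 => .app (Tm.ofCode k.unpair.1) (Tm.ofCode k.unpair.2)
    | 3 => .fix (Tm.ofCode k)
    | 4 => .ite (Tm.ofCode k.unpair.1) (Tm.ofCode k.unpair.2.unpair.1)
        (Tm.ofCode k.unpair.2.unpair.2)
    | 5 => .raise (Ty.ofCode k.unpair.1) (Tm.ofCode k.unpair.2)
    | _ => .handle (Ty.ofCode k.unpair.1) (Tm.ofCode k.unpair.2.unpair.1)
        (Tm.ofCode k.unpair.2.unpair.2)
termination_by n => n
decreasing_by all_goals assumption

theorem Tm.ofCode_code (M : Tm) : Tm.ofCode M.code = M := by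
  have key : ∀ k r : ℕ, r < 7 → (7 * k + r) / 7 = k ∧ (7 * k + r) % 7 = r := by
    intro k r hr; omega
  induction M with
  | fail => simp [Tm.code, Tm.ofCode]
  | unit => simp [Tm.code, Tm.ofCode]
  | tt => simp [Tm.code, Tm.ofCode]
  | ff => simp [Tm.code, Tm.ofCode]
  | var n =>
    rw [Tm.code, Tm.ofCode]
    simp
  | lam M h =>
    rw [Tm.code, show 7 * M.code + 5 = (7 * M.code + 1) + 4 from rfl, Tm.ofCode]
    obtain ⟨h₁, h₂⟩ := key M.code 1 (by omega)
    simp [h₁, h₂, h]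
  | app M N hM hN =>
    rw [Tm.code, show ∀ a, 7 * a + 6 = (7 * a + 2) + 4 from fun _ => rfl, Tm.ofCode]
    obtain ⟨h₁, h₂⟩ := key (Nat.pair M.code N.code) 2 (by omega)
    simp [h₁, h₂, hM, hN]
  | fix M h =>
    rw [Tm.code, show 7 * M.code + 7 = (7 * M.code + 3) + 4 from rfl, Tm.ofCode]
    obtain ⟨h₁, h₂⟩ := key M.code 3 (by omega)
    simp [h₁, h₂, h]
  | ite L M N hL hM hN =>
    rw [Tm.code, show ∀ a, 7 * a + 8 = (7 * a + 4) + 4 from fun _ => rfl, Tm.ofCode]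
    obtain ⟨h₁, h₂⟩ := key (Nat.pair L.code (Nat.pair M.code N.code)) 4 (by omega)
    simp [h₁, h₂, hL, hM, hN]
  | raise σ M hM =>
    rw [Tm.code, show ∀ a, 7 * a + 9 = (7 * a + 5) + 4 from fun _ => rfl, Tm.ofCode]
    obtain ⟨h₁, h₂⟩ := key (Nat.pair σ.code M.code) 5 (by omega)
    simp [h₁, h₂, hM, Ty.ofCode_code]
  | handle σ M N hM hN =>
    rw [Tm.code, show ∀ a, 7 * a + 10 = (7 * a + 6) + 4 from fun _ => rfl, Tm.ofCode]
    obtain ⟨h₁, h₂⟩ := key (Nat.pair σ.code (Nat.pair M.code N.code)) 6 (by omega)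
    simp [h₁, h₂, hM, hN, Ty.ofCode_code]

theorem Tm.code_ofCode (n : ℕ) : (Tm.ofCode n).code = n := by
  induction n using Nat.strong_induction_on with
  | _ n ih =>
    match n with
    | 0 => simp [Tm.code, Tm.ofCode]
    | 1 => simp [Tm.code, Tm.ofCode]
    | 2 => simp [Tm.code, Tm.ofCode]
    | 3 => simp [Tm.code, Tm.ofCode]
    | n + 4 =>
      have h0 : n / 7 < n + 4 := by omega
      have h1 : (n / 7).unpair.1 < n + 4 := lt_of_le_of_lt (Nat.unpair_left_le _) h0
      have h2 : (n / 7).unpair.2 < n + 4 := lt_of_le_of_lt (Nat.unpair_right_le _) h0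
      have h21 : (n / 7).unpair.2.unpair.1 < n + 4 := lt_of_le_of_lt (Nat.unpair_left_le _) h2
      have h22 : (n / 7).unpair.2.unpair.2 < n + 4 := lt_of_le_of_lt (Nat.unpair_right_le _) h2
      have e0 := ih _ h0
      have e1 := ih _ h1
      have e2 := ih _ h2
      have e21 := ih _ h21
      have e22 := ih _ h22
      have hr : n % 7 < 7 := Nat.mod_lt _ (by norm_num)
      have hd := Nat.div_add_mod n 7
      rw [Tm.ofCode]
      generalize n % 7 = r at hr hd
      interval_cases r <;>
        simp only [Tm.code, e0, e1, e2, e21, e22, Ty.code_ofCode, Nat.pair_unpair] <;> omega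

/-- The Gödel numbering of expressions is a bijection. -/
def Tm.equivNat : Tm ≃ ℕ where
  toFun := Tm.code
  invFun := Tm.ofCode
  left_inv := Tm.ofCode_code
  right_inv := Tm.code_ofCode

/-- Computability on expressions refers to this numbering. -/
instance : Denumerable Tm := Denumerable.mk' Tm.equivNat

/-- The decision problem with set of instances `D` and question `R` is decidable: some algorithm
answers `R` correctly on every instance in `D` (on other inputs its answer is irrelevant). -/
def DecidableProblem {α : Type} [Primcodable α] (D R : α → Prop) : Prop :=
  ∃ p : α → Prop, ComputablePred p ∧ ∀ a, D a → (p a ↔ R a)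

end BPCF

/-! The type unit → unit can hold every natural number, because an exception of this type may carry
a function that raises again: with exceptions it behaves like the recursive type N = 1 + N. `num 0`
returns and `num (n + 1)` raises `num n`, so a handler is a zero test and a predecessor at once.
Together with Y this suffices to compile every partial recursive function f to a term T, and T
applied to the input and to the continuation λx. fail reaches `fail` exactly when f is defined
there. The only exception used is that of unit → unit.

The obstacle is that, without the optional rule, a handler whose body has become a value is stuck.
Hence the zero branch of a case analysis runs inside the handler, and compiled functions are in
continuation-passing style: results are passed on and never returned through a handler. The handlers
left behind form an evaluation context, which `Yields` allows. They are harmless, since each numeral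
is forced directly below a handler of its own and `fail` discards any context. No step depends on
the optional rule, so one argument covers both versions.

For undefined values reduction is shown to be deterministic (`Step.deterministic`), so that a
computation that goes on forever never meets `fail`. Case analysis is `Yields.caseNat_zero` and
`Run.caseNat_succ`; `definable_of_primrec`, `Definable.comp` and `Definable.rfind` give
`definable_of_partrec`, and `exists_primrec_reachesFail_iff` transfers the halting problem. -/

namespace BPCF

open Relation (ReflTransGen TransGen)

/-! ### Determinism of reduction -/

/-- What an expression does next. -/
inductive Outcome : Type
  | value : Outcome
  | fails : Outcome
  | raises : Ty → Tm → Outcome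
  | steps : Tm → Outcome
  | stuck : Outcome

/-- Pass the next step of a subexpression in evaluation position on to the whole expression. -/
def Outcome.within : Outcome → (Tm → Tm) → Outcome → Outcome
  | .value, _, onValue => onValue
  | .steps M, C, _ => .steps (C M)
  | r, _, _ => r

/-- The contraction of the application of a value to a value. -/
def Tm.applyOutcome : Tm → Tm → Outcome
  | .lam M, V => .steps (M.inst V)
  | _, _ => .stuck

/-- The contraction of a conditional on a value. -/
def Tm.iteOutcome : Tm → Tm → Tm → Outcome
  | .tt, M, _ => .steps M
  | .ff, _, N => .steps N
  | _, _, _ => .stuck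

open Classical in
/-- The effect of a handler on the outcome of its body. -/
noncomputable def Outcome.handled :
    Outcome → (Tm → Tm) → Outcome → Ty → Tm → Outcome
  | .raises τ V, _, _, σ, N => if τ = σ then .steps (N.inst V) else .raises τ V
  | r, C, onValue, _, _ => r.within C onValue

/-- The next step of an expression, as a function. -/
noncomputable def Tm.outcome (ret : Bool) : Tm → Outcome
  | .fail => .fails
  | .unit => .value
  | .tt => .value
  | .ff => .value
  | .lam _ => .value
  | .var _ => .stuck
  | .fix M => .steps (.lam (M.subst (liftSub (single (.fix M)))))
  | .app M N => (M.outcome ret).within (fun M' => .app M' N)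
      ((N.outcome ret).within (fun N' => .app M N') (M.applyOutcome N))
  | .ite L M N => (L.outcome ret).within (fun L' => .ite L' M N) (L.iteOutcome M N)
  | .raise σ M => (M.outcome ret).within (fun M' => .raise σ M') (.raises σ M)
  | .handle σ M N => (M.outcome ret).handled (fun M' => .handle σ M' N)
      (if ret then .steps M else .stuck) σ N

theorem Tm.IsValue.outcome {ret : Bool} {V : Tm} (h : V.IsValue) : V.outcome ret = .value := by
  cases V <;> simp_all [Tm.IsValue, Tm.outcome]

theorem ECtx.outcome_plug_steps {ret : Bool} (E : ECtx) {M N : Tm}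
    (h : M.outcome ret = .steps N) : (E.plug M).outcome ret = .steps (E.plug N) := by
  induction E with
  | hole => exact h
  | appR V hV E ih => simp [ECtx.plug, Tm.outcome, ih, hV.outcome, Outcome.within]
  | _ => simp_all [ECtx.plug, Tm.outcome, Outcome.within, Outcome.handled]

theorem ECtx.outcome_plug_fail {ret : Bool} (E : ECtx) :
    (E.plug .fail).outcome ret = .fails := by
  induction E with
  | hole => rfl
  | appR V hV E ih => simp [ECtx.plug, Tm.outcome, ih, hV.outcome, Outcome.within]
  | _ => simp_all [ECtx.plug, Tm.outcome, Outcome.within, Outcome.handled]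

theorem ECtx.outcome_plug_raise {ret : Bool} (E : ECtx) {σ : Ty} {V : Tm} (hV : V.IsValue)
    (hE : ¬ E.Handles σ) : (E.plug (.raise σ V)).outcome ret = .raises σ V := by
  induction E with
  | hole => simp [ECtx.plug, Tm.outcome, hV.outcome, Outcome.within]
  | appR W hW E ih =>
    simp [ECtx.plug, Tm.outcome, ih hE, hW.outcome, Outcome.within]
  | handle τ E N ih =>
    simp only [ECtx.Handles, not_or] at hE
    simp [ECtx.plug, Tm.outcome, ih hE.2, Outcome.handled, Ne.symm hE.1]
  | _ => simp_all [ECtx.plug, ECtx.Handles, Tm.outcome, Outcome.within]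

/-- This replaces unique decomposition into context and redex: the outcome of a redex is computed,
and contexts propagate it. `fails` is separate from `steps` because `fail` discards its context,
`raises` because an exception travels to the nearest matching handler. -/
theorem Step.outcome {ret : Bool} {M N : Tm} (h : Step ret M N) :
    M.outcome ret = .steps N ∨ (M.outcome ret = .fails ∧ N = .fail) := by
  cases h with
  | beta E M V hV =>
    exact .inl (E.outcome_plug_steps
      (by simp [Tm.outcome, Outcome.within, hV.outcome, Tm.applyOutcome]))
  | iteTrue E M N =>
    exact .inl (E.outcome_plug_steps (by simp [Tm.outcome, Outcome.within, Tm.iteOutcome]))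
  | iteFalse E M N =>
    exact .inl (E.outcome_plug_steps (by simp [Tm.outcome, Outcome.within, Tm.iteOutcome]))
  | fail E => exact .inr ⟨E.outcome_plug_fail, rfl⟩
  | unfold E M => exact .inl (E.outcome_plug_steps rfl)
  | catchExc E E' σ V N hV hE' =>
    exact .inl (E.outcome_plug_steps
      (by simp [Tm.outcome, Outcome.handled, E'.outcome_plug_raise hV hE']))
  | handleValue E σ V N hV hret =>
    exact .inl (E.outcome_plug_steps
      (by simp [Tm.outcome, Outcome.handled, Outcome.within, hV.outcome, hret]))

theorem Step.deterministic {ret : Bool} {M N N' : Tm} (h : Step ret M N) (h' : Step ret M N') :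
    N = N' := by
  rcases h.outcome with h | ⟨h, rfl⟩ <;> rcases h'.outcome with h' | ⟨h', rfl⟩ <;> simp_all

theorem Step.eq_fail {ret : Bool} {N : Tm} (h : Step ret .fail N) : N = .fail := by
  simpa [Tm.outcome] using h.outcome

theorem eq_fail_of_reduct {ret : Bool} {N : Tm} (h : ReflTransGen (Step ret) .fail N) :
    N = .fail := by
  induction h with
  | refl => rfl
  | tail _ hs ih => exact (ih ▸ hs).eq_fail

/-- By determinism every reduct lies on the single path to `fail`, or on the loop from `fail` to
itself. -/
theorem ReachesFail.of_reduct {ret : Bool} {M N : Tm} (hM : ReachesFail ret M)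
    (h : ReflTransGen (Step ret) M N) : ReachesFail ret N := by
  induction h with
  | refl => exact hM
  | tail _ hs ih =>
    rcases ih.cases_head with rfl | ⟨N', hN', h'⟩
    · rw [hs.eq_fail]
      exact .refl
    · rwa [hs.deterministic hN']

/-- An expression from which reduction can go on forever without passing through `fail` does not
reach `fail`. -/
theorem not_reachesFail_of_progress {ret : Bool} {P : Tm → Prop} (hfail : ¬ P .fail)
    (hP : ∀ M, P M → ∃ N, P N ∧ TransGen (Step ret) M N) {M : Tm} (hM : P M) :
    ¬ ReachesFail ret M := by
  intro h
  -- Generalized for induction along the path to `fail`: from no point of it can an expression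
  -- satisfying `P` still lie ahead.
  suffices ∀ N, P N → ¬ ReflTransGen (Step ret) M N from this M hM .refl
  refine ReflTransGen.head_induction_on h ?_ ?_
  · intro N hN hr
    exact hfail (eq_fail_of_reduct hr ▸ hN)
  · intro A B hAB _ ih N hN hr
    rcases hr.cases_head with rfl | ⟨B', hB', hr'⟩
    · obtain ⟨N', hN', ht⟩ := hP _ hN
      obtain ⟨B', hB', hr'⟩ := TransGen.head'_iff.1 ht
      rw [← hAB.deterministic hB'] at hr'
      exact ih N' hN' hr'
    · rw [← hAB.deterministic hB'] at hr'
      exact ih N hN hr'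

/-! ### Reduction inside evaluation contexts -/

/-- Composition of evaluation contexts. -/
def ECtx.comp : ECtx → ECtx → ECtx
  | .hole, C => C
  | .appL E N, C => .appL (E.comp C) N
  | .appR V h E, C => .appR V h (E.comp C)
  | .ite E M N, C => .ite (E.comp C) M N
  | .raise σ E, C => .raise σ (E.comp C)
  | .handle σ E N, C => .handle σ (E.comp C) N

theorem ECtx.plug_comp (E C : ECtx) (M : Tm) : (E.comp C).plug M = E.plug (C.plug M) := by
  induction E <;> simp_all [ECtx.plug, ECtx.comp]

/-- `M` reduces to `N` inside any evaluation context. -/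
def Run (ret : Bool) (M N : Tm) : Prop :=
  ∀ E : ECtx, ReflTransGen (Step ret) (E.plug M) (E.plug N)

/-- `M` reduces to `N`, below a fixed evaluation context, inside any evaluation context. -/
def Yields (ret : Bool) (M N : Tm) : Prop :=
  ∃ C : ECtx, Run ret M (C.plug N)

/-- `M` does not reach `fail` inside any evaluation context. -/
def Diverges (ret : Bool) (M : Tm) : Prop :=
  ∀ E : ECtx, ¬ ReachesFail ret (E.plug M)

variable {ret : Bool} {M N L : Tm} {n m : ℕ}

theorem Run.refl (M : Tm) : Run ret M M := fun _ => .refl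

theorem Run.trans (h : Run ret M N) (h' : Run ret N L) : Run ret M L :=
  fun E => (h E).trans (h' E)

theorem Run.plug (h : Run ret M N) (C : ECtx) : Run ret (C.plug M) (C.plug N) := fun E => by
  simpa [ECtx.plug_comp] using h (E.comp C)

theorem Run.appL (h : Run ret M N) (L : Tm) : Run ret (.app M L) (.app N L) :=
  h.plug (.appL .hole L)

theorem Run.beta {V : Tm} (hV : V.IsValue) : Run ret (.app (.lam M) V) (M.inst V) :=
  fun E => .single (.beta E M V hV)

theorem Run.unfold : Run ret (.fix M) (.lam (M.subst (liftSub (single (.fix M))))) :=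
  fun E => .single (.unfold E M)

theorem Run.beta₂ {V W : Tm} (hV : V.IsValue) (hW : W.IsValue) :
    Run ret (.app (.app (.lam (.lam M)) V) W) ((M.subst (liftSub (single V))).inst W) :=
  ((Run.beta hV).appL W).trans (.beta hW)

theorem Run.yields (h : Run ret M N) : Yields ret M N := ⟨.hole, h⟩

theorem Yields.trans (h : Yields ret M N) (h' : Yields ret N L) : Yields ret M L := by
  obtain ⟨C, h⟩ := h
  obtain ⟨C', h'⟩ := h'
  exact ⟨C.comp C', by simpa [ECtx.plug_comp] using h.trans (h'.plug C)⟩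

theorem Run.trans_yields (h : Run ret M N) (h' : Yields ret N L) : Yields ret M L :=
  h.yields.trans h'

/-- Divergence is demanded in every context precisely so that it absorbs the context left behind by
`Yields`. -/
theorem Diverges.of_yields (h' : Diverges ret N) (h : Yields ret M N) : Diverges ret M := by
  obtain ⟨C, h⟩ := h
  intro E hE
  refine h' (E.comp C) ?_
  rw [ECtx.plug_comp]
  exact hE.of_reduct (h E)

theorem ECtx.plug_eq_fail {E : ECtx} (h : E.plug M = .fail) : M = .fail := by
  cases E <;> simp_all [ECtx.plug]

/-! ### Closed expressions -/

/-- Renaming and substitution do nothing to the expression. -/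
structure Tm.Closed (M : Tm) : Prop where
  subst : ∀ s, M.subst s = M
  rename : ∀ ρ, M.rename ρ = M

theorem HasTy.subst_eq {Γ : List Ty} {τ : Ty} (h : HasTy Γ M τ) :
    ∀ s : ℕ → Tm, (∀ n < Γ.length, s n = .var n) → M.subst s = M := by
  have key : ∀ (Γ : List Ty) (σ : Ty) (s : ℕ → Tm), (∀ n < Γ.length, s n = .var n) →
      ∀ n < (σ :: Γ).length, liftSub s n = .var n := by
    intro Γ σ s hs n hn
    cases n with
    | zero => rfl
    | succ n => simp [liftSub, hs n (by simpa using hn), Tm.rename]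
  induction h with
  | var Γ n τ h =>
    intro s hs
    exact hs n (List.getElem?_eq_some_iff.1 h).1
  | lam Γ σ τ M h ih => intro s hs; simp [Tm.subst, ih _ (key _ _ _ hs)]
  | fix Γ σ τ M h ih => intro s hs; simp [Tm.subst, ih _ (key _ _ _ (key _ _ _ hs))]
  | handle Γ σ τ M N _ _ ihM ihN =>
    intro s hs; simp [Tm.subst, ihM _ hs, ihN _ (key _ _ _ hs)]
  | _ => intro s hs; simp_all [Tm.subst]

theorem HasTy.rename_eq {Γ : List Ty} {τ : Ty} (h : HasTy Γ M τ) :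
    ∀ ρ : ℕ → ℕ, (∀ n < Γ.length, ρ n = n) → M.rename ρ = M := by
  have key : ∀ (Γ : List Ty) (σ : Ty) (ρ : ℕ → ℕ), (∀ n < Γ.length, ρ n = n) →
      ∀ n < (σ :: Γ).length, liftRen ρ n = n := by
    intro Γ σ ρ hs n hn
    cases n with
    | zero => rfl
    | succ n => simp [liftRen, hs n (by simpa using hn)]
  induction h with
  | var Γ n τ h =>
    intro ρ hs
    exact congrArg Tm.var (hs n (List.getElem?_eq_some_iff.1 h).1)
  | lam Γ σ τ M h ih => intro s hs; simp [Tm.rename, ih _ (key _ _ _ hs)]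
  | fix Γ σ τ M h ih => intro s hs; simp [Tm.rename, ih _ (key _ _ _ (key _ _ _ hs))]
  | handle Γ σ τ M N _ _ ihM ihN =>
    intro s hs; simp [Tm.rename, ihM _ hs, ihN _ (key _ _ _ hs)]
  | _ => intro s hs; simp_all [Tm.rename]

theorem HasTy.closed {τ : Ty} (h : HasTy [] M τ) : M.Closed :=
  ⟨fun s => h.subst_eq s (by simp), fun ρ => h.rename_eq ρ (by simp)⟩

theorem HasTy.append {Γ : List Ty} {τ : Ty} (h : HasTy Γ M τ) (Δ : List Ty) :
    HasTy (Γ ++ Δ) M τ := by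
  induction h with
  | var Γ n τ h =>
    refine .var _ _ _ ?_
    rw [List.getElem?_append_left (List.getElem?_eq_some_iff.1 h).1, h]
  | fail => exact .fail _ _
  | unit => exact .unit _
  | tt => exact .tt _
  | ff => exact .ff _
  | lam Γ σ τ M h ih => exact .lam _ _ _ _ ih
  | app Γ σ τ M N _ _ ihM ihN => exact .app _ _ _ _ _ ihM ihN
  | fix Γ σ τ M h ih => exact .fix _ _ _ _ ih
  | ite Γ τ L M N _ _ _ ihL ihM ihN => exact .ite _ _ _ _ _ ihL ihM ihN
  | raise Γ σ τ M h ih => exact .raise _ _ _ _ ih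
  | handle Γ σ τ M N _ _ ihM ihN => exact .handle _ _ _ _ _ ihM ihN

theorem HasTy.weaken {τ : Ty} (h : HasTy [] M τ) (Γ : List Ty) : HasTy Γ M τ := h.append Γ

/-! ### Natural numbers and vectors -/

/-- The type of the representatives of natural numbers. -/
def natTy : Ty := .arr .unit .unit

/-- The representative of a natural number: a function that returns if the number is `0`, and raises
the predecessor otherwise. -/
def num : ℕ → Tm
  | 0 => .lam .unit
  | n + 1 => .lam (.raise natTy (num n))

/-- The type of the representatives of vectors of length `n`. -/
def vecTy : ℕ → Ty
  | 0 => .unit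
  | n + 1 => .arr (.arr natTy (.arr (vecTy n) .unit)) .unit

/-- The representative of a vector: a function that passes head and tail to its argument. -/
def vec : List ℕ → Tm
  | [] => .unit
  | d :: l => .lam (.app (.app (.var 0) (num d)) (vec l))

/-- Case analysis on a natural number. Both branches are under one binder: a dummy one in the first
branch, the predecessor in the second branch. -/
def Tm.caseNat (d M N : Tm) : Tm :=
  .handle natTy (.app (.lam M) (.app d .unit)) N

theorem num_isValue (n : ℕ) : (num n).IsValue := by cases n <;> trivial

theorem vec_isValue (l : List ℕ) : (vec l).IsValue := by cases l <;> trivial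

theorem num_hasTy (n : ℕ) (Γ : List Ty) : HasTy Γ (num n) natTy := by
  induction n generalizing Γ with
  | zero => exact .lam _ _ _ _ (.unit _)
  | succ n ih => exact .lam _ _ _ _ (.raise _ _ _ _ (ih _))

theorem vec_hasTy (l : List ℕ) (Γ : List Ty) : HasTy Γ (vec l) (vecTy l.length) := by
  induction l generalizing Γ with
  | nil => exact .unit _
  | cons d l ih =>
    exact .lam _ _ _ _ (.app _ _ _ _ _ (.app _ _ _ _ _ (.var _ _ _ rfl) (num_hasTy d _)) (ih _))

theorem num_closed (n : ℕ) : (num n).Closed := (num_hasTy n []).closed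

theorem vec_closed (l : List ℕ) : (vec l).Closed := (vec_hasTy l []).closed

theorem num_onlyExc (n : ℕ) : (num n).OnlyExc natTy := by
  induction n with
  | zero => trivial
  | succ n ih => exact ⟨rfl, ih⟩

theorem vec_onlyExc (l : List ℕ) : (vec l).OnlyExc natTy := by
  induction l with
  | nil => trivial
  | cons d l ih => exact ⟨⟨trivial, num_onlyExc d⟩, ih⟩

/-- The dummy abstraction delays `M` until the numeral has returned. The handler stays around the
branch, hence `Yields` and not `Run`. -/
theorem Yields.caseNat_zero : Yields ret ((num 0).caseNat M N) (M.inst .unit) := by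
  have h : Run ret (.app (num 0) .unit) .unit := .beta trivial
  refine ⟨.handle natTy .hole N, ?_⟩
  exact ((h.plug (.appR (.lam M) trivial .hole)).trans (.beta trivial)).plug
    (.handle natTy .hole N)

/-- The exception meets this handler before any outer one, and catching it discards both the pending
zero branch and the handler. -/
theorem Run.caseNat_succ (n : ℕ) : Run ret ((num (n + 1)).caseNat M N) (N.inst (num n)) := by
  have h : Run ret (.app (num (n + 1)) .unit) (.raise natTy (num n)) := by
    simpa [num, Tm.inst, Tm.subst, (num_closed n).subst]
      using Run.beta (ret := ret) (M := .raise natTy (num n)) (V := .unit) trivial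
  refine (h.plug (.handle natTy (.appR (.lam M) trivial .hole) N)).trans fun E => ?_
  exact .single (.catchExc E (.appR (.lam M) trivial .hole) natTy (num n) N (num_isValue n) id)

theorem Run.vec_cons (d : ℕ) (l : List ℕ) (k : Tm) :
    Run ret (.app (vec (d :: l)) (.lam k)) (.app (.app (.lam k) (num d)) (vec l)) := by
  simpa [vec, Tm.inst, Tm.subst, (num_closed d).subst, (vec_closed l).subst, single]
    using Run.beta (ret := ret) (M := .app (.app (.var 0) (num d)) (vec l)) (V := .lam k) trivial

/-! ### Partial functions as expressions in continuation-passing style -/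

/-- The type of functions on vectors of length `n` with values in `τ`, in continuation-passing
style. -/
def funTy (n : ℕ) (τ : Ty) : Ty := .arr (vecTy n) (.arr (.arr τ .unit) .unit)

/-- `T` computes the partial function `f`, whose values are represented by expressions of type `τ`
by means of `q`. -/
structure Computes (ret : Bool) {n : ℕ} {α : Type} (τ : Ty) (q : α → Tm)
    (f : List.Vector ℕ n →. α) (T : Tm) : Prop where
  hasTy : HasTy [] T (funTy n τ)
  onlyExc : T.OnlyExc natTy
  yields : ∀ v, ∀ a ∈ f v, ∀ k, k.IsValue → k.Closed →
    Yields ret (.app (.app T (vec v.toList)) k) (.app k (q a))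
  diverges : ∀ v, ¬ (f v).Dom → ∀ k, k.IsValue → k.Closed →
    Diverges ret (.app (.app T (vec v.toList)) k)

/-- `f` is computed by some expression, with natural numbers as values. -/
def Definable (ret : Bool) {n : ℕ} (f : List.Vector ℕ n →. ℕ) : Prop :=
  ∃ T, Computes ret natTy num f T

/-- For total functions there is no divergence to take care of. -/
theorem Computes.of_total {n : ℕ} {α : Type} {τ : Ty} {q : α → Tm} {f : List.Vector ℕ n → α}
    {T : Tm} (hT : HasTy [] T (funTy n τ)) (hE : T.OnlyExc natTy)
    (h : ∀ v k, k.IsValue → k.Closed →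
      Yields ret (.app (.app T (vec v.toList)) k) (.app k (q (f v)))) :
    Computes ret τ q (fun v => Part.some (f v)) T where
  hasTy := hT
  onlyExc := hE
  yields v a ha k := by rw [Part.mem_some_iff.1 ha]; exact h v k
  diverges v hv := absurd trivial hv

theorem definable_zero : Definable ret (n := 0) fun _ => Part.some 0 := by
  refine ⟨.lam (.lam (.app (.var 0) (num 0))), .of_total ?_ ?_ ?_⟩
  · exact .lam _ _ _ _ (.lam _ _ _ _ (.app _ natTy _ _ _ (.var _ _ _ rfl) (num_hasTy _ _)))
  · simp [Tm.OnlyExc, num]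
  · intro v k hk hc
    simpa [Tm.inst, Tm.subst, single, liftSub, num] using
      (Run.beta₂ (ret := ret) (M := .app (.var 0) (num 0)) (vec_isValue v.toList) hk).yields

/-- The expression for a function that takes its argument apart, where `T` expects head, tail and
continuation. -/
def uncons (T : Tm) : Tm :=
  .lam (.lam (.app (.var 1) (.lam (.lam (.app (.app (.app T (.var 1)) (.var 0)) (.var 2))))))

theorem uncons_hasTy {T : Tm} {τ : Ty} (h : HasTy [] T (.arr natTy (funTy n τ))) :
    HasTy [] (uncons T) (funTy (n + 1) τ) := by
  refine .lam _ _ _ _ (.lam _ _ _ _ (.app _ (.arr natTy (.arr (vecTy n) .unit)) _ _ _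
    (.var _ _ _ rfl) (.lam _ _ _ _ (.lam _ _ _ _ (.app _ _ _ _ _ (.app _ _ _ _ _
      (.app _ _ _ _ _ (h.weaken _) ?_) ?_) ?_)))))
  all_goals exact .var _ _ _ rfl

theorem uncons_run {T k : Tm} (hT : T.Closed) (hk : k.IsValue) (hc : k.Closed) (d : ℕ)
    (l : List ℕ) : Run ret (.app (.app (uncons T) (vec (d :: l))) k)
      (.app (.app (.app T (num d)) (vec l)) k) := by
  have h₁ := Run.beta₂ (ret := ret) (M := .app (.var 1)
    (.lam (.lam (.app (.app (.app T (.var 1)) (.var 0)) (.var 2))))) (vec_isValue (d :: l)) hk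
  have h₂ := Run.vec_cons (ret := ret) d l
    (.lam (.app (.app (.app T (.var 1)) (.var 0)) k))
  have h₃ := Run.beta₂ (ret := ret) (M := .app (.app (.app T (.var 1)) (.var 0)) k)
    (num_isValue d) (vec_isValue l)
  simp [Tm.inst, Tm.subst, single, liftSub, Tm.rename, hT.subst, hc.subst, hc.rename,
    (vec_closed _).subst, (vec_closed _).rename, (num_closed _).subst, (num_closed _).rename]
    at h₁ h₂ h₃
  exact (h₁.trans h₂).trans h₃

theorem Run.beta₃ {U V W : Tm} (hU : U.IsValue) (hV : V.IsValue) (hW : W.IsValue) :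
    Run ret (.app (.app (.app (.lam (.lam (.lam M))) U) V) W)
      (((M.subst (liftSub (liftSub (single U)))).subst (liftSub (single V))).inst W) :=
  ((Run.beta₂ hU hV).appL W).trans (.beta hW)

theorem Tm.lam_isValue : (Tm.lam M).IsValue := trivial

theorem definable_of_uncons {f : List.Vector ℕ (n + 1) → ℕ} {T : Tm}
    (hT : HasTy [] T (.arr natTy (funTy n natTy))) (hE : T.OnlyExc natTy)
    (h : ∀ d (w : List.Vector ℕ n) k, k.IsValue → k.Closed →
      Yields ret (.app (.app (.app T (num d)) (vec w.toList)) k) (.app k (num (f (d ::ᵥ w))))) :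
    Definable ret fun v => Part.some (f v) := by
  refine ⟨uncons T, .of_total (uncons_hasTy hT) (by simp [uncons, Tm.OnlyExc, hE]) ?_⟩
  intro v k hk hc
  cases v using List.Vector.casesOn with
  | cons d w =>
    rw [List.Vector.toList_cons]
    exact (uncons_run hT.closed hk hc d _).trans_yields (h d w k hk hc)

theorem definable_succ : Definable ret (n := 1) fun v => Part.some (v.head + 1) := by
  -- Index 3 is the head: the dummy argument of the numeral, the continuation and the tail are bound
  -- further in.
  refine definable_of_uncons (T := .lam (.lam (.lam (.app (.var 0) (.lam (.raise natTy (.var 3)))))))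
    ?_ (by simp [Tm.OnlyExc]) fun d w k hk hc => ?_
  · exact .lam _ _ _ _ (.lam _ _ _ _ (.lam _ _ _ _ (.app _ natTy _ _ _ (.var _ _ _ rfl)
      (.lam _ _ _ _ (.raise _ _ _ _ (.var _ _ _ rfl))))))
  · have h := Run.beta₃ (ret := ret) (M := .app (.var 0) (.lam (.raise natTy (.var 3))))
      (num_isValue d) (vec_isValue w.toList) hk
    simp [Tm.inst, Tm.subst, single, liftSub, (num_closed _).subst, (num_closed _).rename] at h
    simpa [num] using h.yields

theorem definable_get (i : Fin n) :
    Definable ret fun v : List.Vector ℕ n => Part.some (v.get i) := by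
  induction n with
  | zero => exact i.elim0
  | succ n ih =>
    cases i using Fin.cases with
    | zero =>
      refine definable_of_uncons (T := .lam (.lam (.lam (.app (.var 0) (.var 2)))))
        ?_ (by simp [Tm.OnlyExc]) fun d w k hk hc => ?_
      · exact .lam _ _ _ _ (.lam _ _ _ _ (.lam _ _ _ _ (.app _ natTy _ _ _ (.var _ _ _ rfl)
          (.var _ _ _ rfl))))
      · have h := Run.beta₃ (ret := ret) (M := .app (.var 0) (.var 2))
          (num_isValue d) (vec_isValue w.toList) hk
        simp [Tm.inst, Tm.subst, single, liftSub, (num_closed _).subst, (num_closed _).rename] at h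
        simpa using h.yields
    | succ i =>
      obtain ⟨T, hT⟩ := ih i
      refine definable_of_uncons (T := .lam T) (.lam _ _ _ _ (hT.hasTy.weaken _)) hT.onlyExc
        fun d w k hk hc => ?_
      have h := Run.beta (ret := ret) (M := T) (num_isValue d)
      rw [Tm.inst, hT.hasTy.closed.subst] at h
      refine ((h.appL _).appL _).trans_yields ?_
      simpa using hT.yields w _ (Part.mem_some _) k hk hc

/-! ### Composition -/

/-- The components are evaluated in order; each continuation remembers the value just obtained, and
the continuation of the remaining components prepends it to their vector. -/
theorem exists_computes_mOfFn (g : Fin n → List.Vector ℕ m →. ℕ) (hg : ∀ i, Definable ret (g i)) :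
    ∃ T, Computes ret (vecTy n) (fun w : List.Vector ℕ n => vec w.toList)
      (fun v => List.Vector.mOfFn fun i => g i v) T := by
  induction n with
  | zero =>
    refine ⟨.lam (.lam (.app (.var 0) .unit)), .of_total (f := fun _ => List.Vector.nil) ?_ ?_ ?_⟩
    · exact .lam _ _ _ _ (.lam _ _ _ _ (.app _ _ _ _ _ (.var _ _ _ rfl) (.unit _)))
    · simp [Tm.OnlyExc]
    · intro v k hk hc
      simpa [Tm.inst, Tm.subst, single, liftSub, vec] using
        (Run.beta₂ (ret := ret) (M := .app (.var 0) .unit) (vec_isValue v.toList) hk).yields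
  | succ n ih =>
    obtain ⟨G, hG⟩ := hg 0
    obtain ⟨P, hP⟩ := ih (fun i => g i.succ) fun i => hg i.succ
    have hGc := hG.hasTy.closed
    have hPc := hP.hasTy.closed
    have run₁ : ∀ (v : List.Vector ℕ m) k, k.IsValue → k.Closed → Run ret
        (.app (.app (.lam (.lam (.app (.app G (.var 1)) (.lam (.app (.app P (.var 2))
          (.lam (.app (.var 2) (.lam (.app (.app (.var 0) (.var 2)) (.var 1)))))))))) (vec v.toList)) k)
        (.app (.app G (vec v.toList)) (.lam (.app (.app P (vec v.toList))
          (.lam (.app k (.lam (.app (.app (.var 0) (.var 2)) (.var 1)))))))) := by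
      intro v k hk hc
      have h := Run.beta₂ (ret := ret) (M := .app (.app G (.var 1)) (.lam (.app (.app P (.var 2))
          (.lam (.app (.var 2) (.lam (.app (.app (.var 0) (.var 2)) (.var 1)))))))) (vec_isValue v.toList) hk
      simpa [Tm.inst, Tm.subst, single, liftSub, Tm.rename, hGc.subst, hPc.subst, hc.rename,
        (vec_closed _).subst, (vec_closed _).rename] using h
    have closed₁ : ∀ (v : List.Vector ℕ m) (k : Tm), k.Closed →
        (Tm.lam (.app (.app P (vec v.toList))
          (.lam (.app k (.lam (.app (.app (.var 0) (.var 2)) (.var 1))))))).Closed := by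
      intro v k hc
      constructor <;> intro s <;>
        simp [Tm.subst, Tm.rename, liftSub, liftRen, hPc.subst, hPc.rename, hc.subst, hc.rename,
          (vec_closed _).subst, (vec_closed _).rename]
    have run₂ : ∀ (v : List.Vector ℕ m) (a : ℕ) k, k.Closed → Run ret
        (.app (.lam (.app (.app P (vec v.toList))
          (.lam (.app k (.lam (.app (.app (.var 0) (.var 2)) (.var 1))))))) (num a))
        (.app (.app P (vec v.toList))
          (.lam (.app k (.lam (.app (.app (.var 0) (num a)) (.var 1)))))) := by
      intro v a k hc
      have h := Run.beta (ret := ret) (M := .app (.app P (vec v.toList))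
          (.lam (.app k (.lam (.app (.app (.var 0) (.var 2)) (.var 1)))))) (num_isValue a)
      simpa [Tm.inst, Tm.subst, single, liftSub, Tm.rename, hPc.subst, hc.subst,
        (vec_closed _).subst, (num_closed _).rename] using h
    have closed₂ : ∀ (a : ℕ) (k : Tm), k.Closed →
        (Tm.lam (.app k (.lam (.app (.app (.var 0) (num a)) (.var 1))))).Closed := by
      intro a k hc
      constructor <;> intro s <;>
        simp [Tm.subst, Tm.rename, liftSub, liftRen, hc.subst, hc.rename,
          (num_closed _).subst, (num_closed _).rename]
    have run₃ : ∀ (a : ℕ) (w : List.Vector ℕ n) k, k.Closed → Run ret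
        (.app (.lam (.app k (.lam (.app (.app (.var 0) (num a)) (.var 1))))) (vec w.toList))
        (.app k (vec (a ::ᵥ w).toList)) := by
      intro a w k hc
      have h := Run.beta (ret := ret) (M := .app k (.lam (.app (.app (.var 0) (num a)) (.var 1))))
        (vec_isValue w.toList)
      simpa [Tm.inst, Tm.subst, single, liftSub, Tm.rename, hc.subst, vec,
        (vec_closed _).rename, (num_closed _).subst] using h
    refine ⟨_, ?_, ?_, ?_, fun v hv k hk hc => Diverges.of_yields ?_ (run₁ v k hk hc).yields⟩
    · refine .lam _ _ _ _ (.lam _ _ _ _ (.app _ _ _ _ _ (.app _ _ _ _ _ (hG.hasTy.weaken _)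
        (.var _ _ _ rfl)) (.lam _ _ _ _ (.app _ _ _ _ _ (.app _ _ _ _ _ (hP.hasTy.weaken _)
        (.var _ _ _ rfl)) (.lam _ _ _ _ (.app _ (vecTy (n + 1)) _ _ _ (.var _ _ _ rfl)
        (.lam _ _ _ _ (.app _ (vecTy n) _ _ _ (.app _ natTy _ _ _ ?_ ?_) ?_))))))))
      all_goals exact .var _ _ _ rfl
    · simp [Tm.OnlyExc, hG.onlyExc, hP.onlyExc]
    · intro v b hb k hk hc
      simp only [List.Vector.mOfFn, Part.bind_eq_bind, Part.mem_bind_iff, Part.pure_eq_some,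
        Part.mem_some_iff] at hb
      obtain ⟨a, ha, w, hw, rfl⟩ := hb
      exact ((((run₁ v k hk hc).trans_yields
        (hG.yields v a ha _ Tm.lam_isValue (closed₁ v k hc))).trans (run₂ v a k hc).yields).trans
        (hP.yields v w hw _ Tm.lam_isValue (closed₂ a k hc))).trans (run₃ a w k hc).yields
    -- Either the first component diverges, or its continuation is reached and the remaining
    -- components diverge.
    · by_cases h₀ : (g 0 v).Dom
      · have ha := Part.get_mem h₀
        refine Diverges.of_yields (hP.diverges v (fun h₁ => hv ?_) _ Tm.lam_isValue
          (closed₂ ((g 0 v).get h₀) k hc)) ((hG.yields v _ ha _ Tm.lam_isValue (closed₁ v k hc)).trans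
          (run₂ v _ k hc).yields)
        refine Part.dom_iff_mem.2 ⟨(g 0 v).get h₀ ::ᵥ (Part.get _ h₁), ?_⟩
        simp only [List.Vector.mOfFn, Part.bind_eq_bind, Part.mem_bind_iff, Part.pure_eq_some,
          Part.mem_some_iff]
        exact ⟨_, ha, _, Part.get_mem h₁, rfl⟩
      · exact hG.diverges v h₀ _ Tm.lam_isValue (closed₁ v k hc)

theorem Definable.comp {f : List.Vector ℕ n →. ℕ} (g : Fin n → List.Vector ℕ m →. ℕ)
    (hf : Definable ret f) (hg : ∀ i, Definable ret (g i)) :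
    Definable ret fun v => (List.Vector.mOfFn fun i => g i v) >>= f := by
  obtain ⟨F, hF⟩ := hf
  obtain ⟨P, hP⟩ := exists_computes_mOfFn g hg
  have hFc := hF.hasTy.closed
  have hPc := hP.hasTy.closed
  have run₁ : ∀ (v : List.Vector ℕ m) k, k.IsValue → k.Closed → Run ret
      (.app (.app (.lam (.lam (.app (.app P (.var 1)) (.lam (.app (.app F (.var 0)) (.var 1))))))
        (vec v.toList)) k)
      (.app (.app P (vec v.toList)) (.lam (.app (.app F (.var 0)) k))) := by
    intro v k hk hc
    have h := Run.beta₂ (ret := ret) (M := .app (.app P (.var 1))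
      (.lam (.app (.app F (.var 0)) (.var 1)))) (vec_isValue v.toList) hk
    simpa [Tm.inst, Tm.subst, single, liftSub, Tm.rename, hFc.subst, hPc.subst, hc.rename,
      (vec_closed _).subst, (vec_closed _).rename] using h
  have closed₁ : ∀ k : Tm, k.Closed → (Tm.lam (.app (.app F (.var 0)) k)).Closed := by
    intro k hc
    constructor <;> intro s <;>
      simp [Tm.subst, Tm.rename, liftSub, liftRen, hFc.subst, hFc.rename, hc.subst, hc.rename]
  have run₂ : ∀ (w : List.Vector ℕ n) k, k.Closed → Run ret
      (.app (.lam (.app (.app F (.var 0)) k)) (vec w.toList))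
      (.app (.app F (vec w.toList)) k) := by
    intro w k hc
    have h := Run.beta (ret := ret) (M := .app (.app F (.var 0)) k) (vec_isValue w.toList)
    simpa [Tm.inst, Tm.subst, single, hFc.subst, hc.subst] using h
  refine ⟨_, ?_, ?_, ?_, fun v hv k hk hc => Diverges.of_yields ?_ (run₁ v k hk hc).yields⟩
  · refine .lam _ _ _ _ (.lam _ _ _ _ (.app _ _ _ _ _ (.app _ _ _ _ _ (hP.hasTy.weaken _) ?_)
      (.lam _ _ _ _ (.app _ _ _ _ _ (.app _ _ _ _ _ (hF.hasTy.weaken _) ?_) ?_))))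
    all_goals exact .var _ _ _ rfl
  · simp [Tm.OnlyExc, hF.onlyExc, hP.onlyExc]
  · intro v b hb k hk hc
    obtain ⟨w, hw, hb⟩ := Part.mem_bind_iff.1 hb
    exact (((run₁ v k hk hc).trans_yields (hP.yields v w hw _ Tm.lam_isValue (closed₁ k hc))).trans
      (run₂ w k hc).yields).trans (hF.yields w b hb k hk hc)
  · by_cases h₀ : (List.Vector.mOfFn fun i => g i v).Dom
    · exact Diverges.of_yields (hF.diverges _ (fun h₁ => hv ⟨h₀, h₁⟩) k hk hc)
        ((hP.yields v _ (Part.get_mem h₀) _ Tm.lam_isValue (closed₁ k hc)).trans (run₂ _ k hc).yields)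
    · exact hP.diverges v h₀ _ Tm.lam_isValue (closed₁ k hc)

/-! ### Recursion -/

/-- The body of the expression for primitive recursion with base case `F` and recursion step `G`. -/
def precBody (F G : Tm) : Tm :=
  .lam (.lam ((Tm.var 2).caseNat (.app (.app F (.var 2)) (.var 1))
    (.app (.app (.app (.var 4) (.var 0)) (.var 2))
      (.lam (.app (.app G (.lam (.app (.app (.var 0) (.var 2))
        (.lam (.app (.app (.var 0) (.var 2)) (.var 5)))))) (.var 2))))))

theorem precBody_hasTy {F G : Tm} (hF : HasTy [] F (funTy n natTy))
    (hG : HasTy [] G (funTy (n + 2) natTy)) :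
    HasTy [] (.fix (precBody F G)) (.arr natTy (funTy n natTy)) := by
  refine .fix _ _ _ _ (.lam _ _ _ _ (.lam _ _ _ _ (.handle _ _ _ _ _
    (.app _ .unit _ _ _ (.lam _ _ _ _ (.app _ _ _ _ _ (.app _ _ _ _ _ (hF.weaken _) ?_) ?_))
      (.app _ .unit _ _ _ ?_ (.unit _)))
    (.app _ (.arr natTy .unit) _ _ _ (.app _ (vecTy n) _ _ _ (.app _ natTy _ _ _ ?_ ?_) ?_)
      (.lam _ _ _ _ (.app _ _ _ _ _ (.app _ _ _ _ _ (hG.weaken _)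
        (.lam _ _ _ _ (.app _ (vecTy (n + 1)) _ _ _ (.app _ natTy _ _ _ ?_ ?_)
          (.lam _ _ _ _ (.app _ (vecTy n) _ _ _ (.app _ natTy _ _ _ ?_ ?_) ?_))))) ?_))))))
  all_goals exact .var _ _ _ rfl

theorem run_prec {F G k : Tm} (hF : F.Closed) (hG : G.Closed) (hR : (Tm.fix (precBody F G)).Closed)
    (hk : k.IsValue) (hc : k.Closed) (d : ℕ) (l : List ℕ) :
    Run ret (.app (.app (.app (.fix (precBody F G)) (num d)) (vec l)) k)
      ((num d).caseNat (.app (.app F (vec l)) k)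
        (.app (.app (.app (.fix (precBody F G)) (.var 0)) (vec l))
          (.lam (.app (.app G (.lam (.app (.app (.var 0) (.var 2))
            (.lam (.app (.app (.var 0) (.var 2)) (vec l)))))) k)))) := by
  have h₁ := Run.unfold (ret := ret) (M := precBody F G)
  -- The recursive function becomes an opaque closed constant, so that simplification does not
  -- substitute into its body.
  generalize hL : Tm.fix (precBody F G) = R at *
  simp only [precBody, Tm.subst] at h₁
  have h₂ := ((h₁.appL (num d)).appL (vec l)).appL k
  refine h₂.trans ((Run.beta₃ (num_isValue d) (vec_isValue l) hk).trans ?_)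
  simp [Tm.caseNat, Tm.inst, Tm.subst, single, liftSub, Tm.rename, hF.subst, hG.subst,
    hc.rename, hR.subst, hR.rename, (vec_closed _).subst, (vec_closed _).rename,
    (num_closed _).subst, (num_closed _).rename, Run.refl]

/-- Induction on the recursion argument for all continuations at once: the recursive call runs with
a larger continuation, which applies `G` to its result and then `k`. -/
theorem Definable.prec {f : List.Vector ℕ n → ℕ} {g : List.Vector ℕ (n + 2) → ℕ}
    (hf : Definable ret fun v => Part.some (f v)) (hg : Definable ret fun v => Part.some (g v)) :
    Definable ret fun v : List.Vector ℕ (n + 1) => Part.some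
      (v.head.rec (f v.tail) fun y IH => g (y ::ᵥ IH ::ᵥ v.tail) : ℕ) := by
  obtain ⟨F, hF⟩ := hf
  obtain ⟨G, hG⟩ := hg
  have hFc := hF.hasTy.closed
  have hGc := hG.hasTy.closed
  have hR := precBody_hasTy hF.hasTy hG.hasTy
  refine definable_of_uncons hR
    (by simp [precBody, Tm.caseNat, Tm.OnlyExc, hF.onlyExc, hG.onlyExc]) fun d w => ?_
  have hRc := hR.closed
  have run := fun d k hk hc => run_prec (ret := ret) hFc hGc hRc (k := k) hk hc d w.toList
  simp only [List.Vector.head_cons, List.Vector.tail_cons]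
  generalize Tm.fix (precBody F G) = R at *
  induction d with
  | zero =>
    intro k hk hc
    refine (run 0 k hk hc).trans_yields (Yields.caseNat_zero.trans ?_)
    simpa [Tm.inst, Tm.subst, hFc.subst, hc.subst, (vec_closed _).subst] using
      hF.yields w _ (Part.mem_some _) k hk hc
  | succ d ih =>
    intro k hk hc
    refine (run (d + 1) k hk hc).trans_yields
      ((Run.caseNat_succ d).trans_yields ?_)
    have hl : (Tm.lam (.app (.app G (.lam (.app (.app (.var 0) (num d))
        (.lam (.app (.app (.var 0) (.var 2)) (vec w.toList)))))) k)).Closed := by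
      constructor <;> intro s <;>
        simp [Tm.subst, Tm.rename, liftSub, liftRen, hGc.subst, hGc.rename, hc.subst, hc.rename,
          (num_closed _).subst, (num_closed _).rename, (vec_closed _).subst, (vec_closed _).rename]
    have h₁ := ih _ Tm.lam_isValue hl
    change Yields ret _ (.app k (num (g (d ::ᵥ
      (Nat.rec (f w) (fun y IH => g (y ::ᵥ IH ::ᵥ w)) d : ℕ) ::ᵥ w))))
    generalize (Nat.rec (f w) (fun y IH => g (y ::ᵥ IH ::ᵥ w)) d : ℕ) = a at h₁ ⊢
    have h₂ := Run.beta (ret := ret) (M := .app (.app G (.lam (.app (.app (.var 0) (num d))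
        (.lam (.app (.app (.var 0) (.var 2)) (vec w.toList)))))) k) (num_isValue a)
    have h₃ := hG.yields (d ::ᵥ a ::ᵥ w) _ (Part.mem_some _) k hk hc
    simp [Tm.inst, Tm.subst, single, liftSub, hGc.subst, hc.subst, (num_closed _).subst,
      (num_closed _).rename, (vec_closed _).subst] at h₂
    refine Yields.trans ?_ (h₁.trans (h₂.trans_yields (by simpa [vec] using h₃)))
    simp [Tm.inst, Tm.subst, single, liftSub, Tm.rename, hGc.subst, hc.subst, hRc.subst,
      (num_closed _).rename, (vec_closed _).subst, (Run.refl _).yields]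

theorem definable_of_primrec {f : List.Vector ℕ n → ℕ} (hf : Nat.Primrec' f) :
    Definable ret fun v => Part.some (f v) := by
  induction hf with
  | zero => exact definable_zero
  | succ => exact definable_succ
  | get i => exact definable_get i
  | comp g _ _ hf hg =>
    have h := hf.comp _ hg
    have e : ∀ v, (List.Vector.mOfFn fun i => Part.some (g i v)) =
        Part.some (List.Vector.ofFn fun i => g i v) := fun v => List.Vector.mOfFn_pure _
    simpa [e] using h
  | prec _ _ hf hg => exact hf.prec hg

/-! ### Unbounded search -/

/-- The body of the expression for the search for a zero of the function computed by `F`. -/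
def searchBody (F : Tm) : Tm :=
  .lam (.lam (.app (.app F (.lam (.app (.app (.var 0) (.var 3)) (.var 2))))
    (.lam ((Tm.var 0).caseNat (.app (.var 2) (.var 4))
      (.app (.app (.app (.var 5) (.lam (.raise natTy (.var 5)))) (.var 3)) (.var 2))))))

theorem searchBody_hasTy {F : Tm} (hF : HasTy [] F (funTy (n + 1) natTy)) :
    HasTy [] (.fix (searchBody F)) (.arr natTy (funTy n natTy)) := by
  refine .fix _ _ _ _ (.lam _ _ _ _ (.lam _ _ _ _ (.app _ _ _ _ _ (.app _ _ _ _ _ (hF.weaken _)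
    (.lam _ _ _ _ (.app _ (vecTy n) _ _ _ (.app _ natTy _ _ _ ?_ ?_) ?_)))
    (.lam _ _ _ _ (.handle _ _ _ _ _ (.app _ .unit _ _ _ (.lam _ _ _ _ (.app _ natTy _ _ _ ?_ ?_))
      (.app _ .unit _ _ _ ?_ (.unit _)))
      (.app _ (.arr natTy .unit) _ _ _ (.app _ (vecTy n) _ _ _ (.app _ natTy _ _ _ ?_
        (.lam _ _ _ _ (.raise _ _ _ _ ?_))) ?_) ?_))))))
  all_goals exact .var _ _ _ rfl

/-- `TransGen` matters here: unfolding Y is a genuine step, and this strict progress is what makes a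
fruitless search diverge. -/
theorem searchBody_run {F k : Tm} (hF : F.Closed) (hL : (Tm.fix (searchBody F)).Closed)
    (hk : k.IsValue) (hc : k.Closed) (d : ℕ) (l : List ℕ) (E : ECtx) :
    TransGen (Step ret) (E.plug (.app (.app (.app (.fix (searchBody F)) (num d)) (vec l)) k))
      (E.plug (.app (.app F (vec (d :: l))) (.lam ((Tm.var 0).caseNat (.app k (num d))
        (.app (.app (.app (.fix (searchBody F)) (num (d + 1))) (vec l)) k))))) := by
  have h₁ := Step.unfold (ret := ret) (E.comp (.appL (.appL (.appL .hole (num d)) (vec l)) k))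
    (searchBody F)
  generalize hR : Tm.fix (searchBody F) = R at *
  simp only [ECtx.plug_comp, ECtx.plug, searchBody, Tm.subst] at h₁
  refine TransGen.head' h₁ ?_
  refine (Run.beta₃ (num_isValue d) (vec_isValue l) hk).trans ?_ E
  simp [Tm.caseNat, Tm.inst, Tm.subst, single, liftSub, Tm.rename, hF.subst, vec, num,
    hc.rename, hL.subst, hL.rename, (vec_closed _).subst, (vec_closed _).rename,
    (num_closed _).subst, (num_closed _).rename, Run.refl]

theorem Definable.rfind {f : List.Vector ℕ (n + 1) → ℕ}
    (hf : Definable ret fun v => Part.some (f v)) :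
    Definable ret fun v : List.Vector ℕ n =>
      Nat.rfind fun d => Part.some (decide (f (d ::ᵥ v) = 0)) := by
  obtain ⟨F, hF⟩ := hf
  have hFc := hF.hasTy.closed
  have hL := searchBody_hasTy hF.hasTy
  have hLc := hL.closed
  set R := Tm.fix (searchBody F) with hRdef
  have hl : ∀ (v : List.Vector ℕ n) (d : ℕ) (k : Tm), k.Closed →
      (Tm.lam ((Tm.var 0).caseNat (.app k (num d))
        (.app (.app (.app R (num (d + 1))) (vec v.toList)) k))).Closed := by
    intro v d k hc
    constructor <;> intro s <;>
      simp [Tm.caseNat, Tm.subst, Tm.rename, liftSub, liftRen, hLc.subst, hLc.rename, hc.subst,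
        hc.rename, (num_closed _).subst, (num_closed _).rename, (vec_closed _).subst,
        (vec_closed _).rename]
  have test : ∀ (v : List.Vector ℕ n) (d : ℕ) (k : Tm), k.IsValue → k.Closed → Yields ret
      (.app (.app F (vec (d :: v.toList))) (.lam ((Tm.var 0).caseNat (.app k (num d))
        (.app (.app (.app R (num (d + 1))) (vec v.toList)) k))))
      ((num (f (d ::ᵥ v))).caseNat (.app k (num d))
        (.app (.app (.app R (num (d + 1))) (vec v.toList)) k)) := by
    intro v d k hk hc
    have h₁ := hF.yields (d ::ᵥ v) _ (Part.mem_some _) _ Tm.lam_isValue (hl v d k hc)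
    have h₂ := Run.beta (ret := ret) (M := (Tm.var 0).caseNat (.app k (num d))
        (.app (.app (.app R (num (d + 1))) (vec v.toList)) k)) (num_isValue (f (d ::ᵥ v)))
    rw [List.Vector.toList_cons] at h₁
    refine h₁.trans (Run.yields ?_)
    simpa [Tm.caseNat, Tm.inst, Tm.subst, single, hLc.subst, hc.subst, (num_closed _).subst,
      (vec_closed _).subst] using h₂
  have found : ∀ (v : List.Vector ℕ n) (d : ℕ) (k : Tm), k.IsValue → k.Closed → f (d ::ᵥ v) = 0 →
      Yields ret (.app (.app (.app R (num d)) (vec v.toList)) k) (.app k (num d)) := by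
    intro v d k hk hc h0
    have h₁ : Run ret _ _ := fun E => (searchBody_run hFc hLc hk hc d v.toList E).to_reflTransGen
    have h₂ := test v d k hk hc
    rw [h0] at h₂
    refine h₁.trans_yields (h₂.trans (Yields.caseNat_zero.trans (Run.yields ?_)))
    simp [Tm.inst, Tm.subst, hc.subst, (num_closed _).subst, Run.refl]
  -- `C` consists of what the evaluation of `F` leaves behind; it may grow with each round of the
  -- search.
  have next : ∀ (v : List.Vector ℕ n) (d : ℕ) (k : Tm), k.IsValue → k.Closed → f (d ::ᵥ v) ≠ 0 →
      ∃ C : ECtx, ∀ E : ECtx, TransGen (Step ret)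
        (E.plug (.app (.app (.app R (num d)) (vec v.toList)) k))
        (E.plug (C.plug (.app (.app (.app R (num (d + 1))) (vec v.toList)) k))) := by
    intro v d k hk hc h0
    obtain ⟨a, ha⟩ := Nat.exists_eq_succ_of_ne_zero h0
    have h₂ := test v d k hk hc
    rw [ha] at h₂
    obtain ⟨C, hC⟩ := h₂.trans (Run.caseNat_succ a).yields
    refine ⟨C, fun E => (searchBody_run hFc hLc hk hc d v.toList E).trans_left ?_⟩
    simpa [Tm.inst, Tm.subst, hLc.subst, hc.subst, (num_closed _).subst, (vec_closed _).subst]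
      using hC E
  have start : ∀ (v : List.Vector ℕ n) k, k.IsValue → k.Closed → Run ret
      (.app (.app (.lam (.lam (.app (.app (.app R (num 0)) (.var 1)) (.var 0)))) (vec v.toList)) k)
      (.app (.app (.app R (num 0)) (vec v.toList)) k) := by
    intro v k hk hc
    have h := Run.beta₂ (ret := ret) (M := .app (.app (.app R (num 0)) (.var 1)) (.var 0))
      (vec_isValue v.toList) hk
    simpa [Tm.inst, Tm.subst, single, liftSub, hLc.subst, (num_closed _).subst,
      (vec_closed _).subst, (vec_closed _).rename] using h
  refine ⟨_, ?_, ?_, ?_, fun v hv k hk hc => Diverges.of_yields ?_ (start v k hk hc).yields⟩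
  · exact .lam _ _ _ _ (.lam _ _ _ _ (.app _ _ _ _ _ (.app _ _ _ _ _ (.app _ _ _ _ _
      (hL.weaken _) (num_hasTy _ _)) (.var _ _ _ rfl)) (.var _ _ _ rfl)))
  · simp [R, searchBody, Tm.caseNat, Tm.OnlyExc, hF.onlyExc, num_onlyExc]
  · intro v a ha k hk hc
    obtain ⟨ha₀, ha⟩ := Nat.mem_rfind.1 ha
    refine (start v k hk hc).trans_yields (Yields.trans ?_ (found v a k hk hc (by simpa using ha₀)))
    have : ∀ b ≤ a, Yields ret (.app (.app (.app R (num 0)) (vec v.toList)) k)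
        (.app (.app (.app R (num b)) (vec v.toList)) k) := by
      intro b
      induction b with
      | zero => exact fun _ => (Run.refl _).yields
      | succ b ih =>
        intro hb
        obtain ⟨C, hC⟩ := next v b k hk hc (by simpa using ha hb)
        exact (ih (by omega)).trans ⟨C, fun E => (hC E).to_reflTransGen⟩
    exact this a le_rfl
  · have h0 : ∀ d, f (d ::ᵥ v) ≠ 0 := by
      intro d hd
      exact hv (Nat.rfind_dom.2 ⟨d, by simpa using hd, fun _ => trivial⟩)
    intro E
    -- The invariant is a search call in the hole of an arbitrary context, which accommodates the
    -- contexts piled up by earlier rounds.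
    refine not_reachesFail_of_progress
      (P := fun M => ∃ (E : ECtx) (d : ℕ),
        M = E.plug (.app (.app (.app R (num d)) (vec v.toList)) k)) ?_ ?_ ⟨E, 0, rfl⟩
    · rintro ⟨E, d, h⟩
      exact Tm.noConfusion (ECtx.plug_eq_fail h.symm)
    · rintro _ ⟨E, d, rfl⟩
      obtain ⟨C, hC⟩ := next v d k hk hc (h0 d)
      exact ⟨_, ⟨E.comp C, d + 1, (ECtx.plug_comp _ _ _).symm⟩, hC E⟩

/-- `Nat.Partrec'` minimizes total functions only, so an unsuccessful search is the sole origin of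
divergence, and composition merely propagates it. -/
theorem definable_of_partrec {f : List.Vector ℕ n →. ℕ} (hf : Nat.Partrec' f) :
    Definable ret f := by
  induction hf with
  | prim hf => exact definable_of_primrec hf
  | comp g _ _ hf hg => exact hf.comp g hg
  | rfind _ hf => exact hf.rfind

/-! ### Undecidability -/

theorem primrec_lam : Primrec Tm.lam :=
  Primrec.encode_iff.1 <| (Primrec.nat_add.comp (Primrec.nat_mul.comp (.const 7) Primrec.encode)
    (.const 5)).of_eq fun _ => rfl

theorem primrec_app : Primrec₂ Tm.app :=
  Primrec.encode_iff.1 <| (Primrec.nat_add.comp (Primrec.nat_mul.comp (.const 7)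
    (Primrec₂.natPair.comp (Primrec.encode.comp .fst) (Primrec.encode.comp .snd)))
    (.const 6)).of_eq fun _ => rfl

theorem primrec_raise (σ : Ty) : Primrec (Tm.raise σ) :=
  Primrec.encode_iff.1 <| (Primrec.nat_add.comp (Primrec.nat_mul.comp (.const 7)
    (Primrec₂.natPair.comp (.const σ.code) Primrec.encode)) (.const 9)).of_eq fun _ => rfl

theorem primrec_num : Primrec num :=
  (Primrec.nat_rec₁ (num 0) ((primrec_lam.comp (primrec_raise natTy)).comp .snd).to₂).of_eq
    fun n => by
      induction n with
      | zero => rfl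
      | succ n ih => simp only [num, ← ih]

/-- Halting of partial recursive functions reduces to reachability. -/
theorem exists_primrec_reachesFail_iff {f : ℕ →. ℕ} (hf : Partrec f) :
    ∃ P : ℕ → Tm, Primrec P ∧ ∀ n, (IsProgram (P n) ∧ (P n).OnlyExc natTy) ∧
      (ReachesFail ret (P n) ↔ (f n).Dom) := by
  obtain ⟨T, hT⟩ := definable_of_partrec (ret := ret) (Nat.Partrec'.part_iff₁.2 hf)
  refine ⟨fun n => .app (.app T (vec [n])) (.lam .fail), ?_, fun n => ⟨⟨?_, ?_⟩, ?_⟩⟩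
  · exact primrec_app.comp (primrec_app.comp (.const T) (primrec_lam.comp (primrec_app.comp
      (primrec_app.comp (.const (Tm.var 0)) primrec_num) (.const Tm.unit)))) (.const _)
  · exact ⟨.unit, trivial, .app _ _ _ _ _ (.app _ _ _ _ _ hT.hasTy (vec_hasTy [n] _))
      (.lam _ _ _ _ (.fail _ _))⟩
  · exact ⟨⟨hT.onlyExc, vec_onlyExc _⟩, trivial⟩
  · have hk : (Tm.lam .fail).Closed := ⟨fun _ => rfl, fun _ => rfl⟩
    constructor
    · intro h
      by_contra hn
      exact hT.diverges (n ::ᵥ List.Vector.nil) hn _ Tm.lam_isValue hk .hole h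
    · intro h
      obtain ⟨C, hC⟩ := hT.yields (n ::ᵥ List.Vector.nil) _ (Part.get_mem h) _ Tm.lam_isValue hk
      -- The final continuation ignores the computed value, and its `fail` discards the leftover
      -- context `C`.
      exact (hC .hole).trans ((Run.beta (num_isValue _) C).trans (.single (.fail C)))

/-- Any set of instances that contains the compiled programs will do, which covers both halves of
the theorem. The function compiled is c ↦ (code c run on input 0), so one fixed term `T` serves all
instances. -/
theorem not_decidableProblem (D : Tm → Prop)
    (hD : ∀ M, IsProgram M → M.OnlyExc natTy → D M) :
    ¬ DecidableProblem D (ReachesFail ret) := by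
  rintro ⟨p, hp, h⟩
  have hu : Partrec fun n : ℕ => Nat.Partrec.Code.eval (Denumerable.ofNat _ n) 0 :=
    Nat.Partrec.Code.eval_part.comp (Computable.ofNat _) (Computable.const 0)
  obtain ⟨P, hP, hiff⟩ := exists_primrec_reachesFail_iff (ret := ret) hu
  refine ComputablePred.halting_problem 0 (ComputablePred.computable_of_manyOneReducible
    ⟨fun c => P (Encodable.encode c), hP.to_comp.comp Computable.encode, fun c => ?_⟩ hp)
  obtain ⟨⟨h₁, h₂⟩, h₃⟩ := hiff (Encodable.encode c)
  rw [h _ (hD _ h₁ h₂), h₃, Denumerable.ofNat_encode]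

end BPCF

theorem mainTheorem5 (ret : Bool) :
    ¬ BPCF.DecidableProblem BPCF.IsProgram (BPCF.ReachesFail ret) ∧
    ¬ BPCF.DecidableProblem
        (fun M => BPCF.IsProgram M ∧ M.OnlyExc (BPCF.Ty.arr BPCF.Ty.unit BPCF.Ty.unit))
        (BPCF.ReachesFail ret) :=
  ⟨BPCF.not_decidableProblem _ fun _ h _ => h, BPCF.not_decidableProblem _ fun _ h h' => ⟨h, h'⟩⟩
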